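/- Let $X,Z$ be complex Banach spaces and $U,U_d,Y$ complex Hilbert spaces. Consider the discrete-time plant $$x_{n+1}=Ax_n+Bu_n+B_dw_n,\qquad y_n=Cx_n+Du_n+D_dw_n,$$ with bounded linear operators $A,B,B_d,C,D,D_d$ between the appropriate spaces, the exosystem $$v_{n+1}=Sv_n,\qquad w_n=Ev_n,\qquad y^{\mathrm{ref}}_n=-Fv_n,\qquad S=\operatorname{diag}(\mu_1,\dots,\mu_q)\in\mathbb C^{q\times q},$$ with $q\ge 1$, $|\mu_k|=1$ for all $k$, $E\in\mathcal L(\mathbb C^q,U_d)$ and $F\in\mathcal L(\mathbb C^q,Y)$, and the error feedback controller $$z_{n+1}=G_1z_n+G_2e_n,\qquad u_n=Kz_n,\qquad e_n=y_n-y^{\mathrm{ref}}_n,$$ with $G_1\in\mathcal L(Z)$, $G_2\in\mathcal L(Y,Z)$, $K\in\mathcal L(Z,U)$. The closed-loop system is called exponentially stable if the operator $$A_e=\begin{pmatrix}A&BK\\ G_2C&G_1+G_2DK\end{pmatrix}\in\mathcal L(X\times Z)$$ satisfies $\|A_e^n\|\le Me^{-\alpha n}$ for all $n\ge 0$ and some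 $M,\alpha>0$. The controller solves the output regulation problem if the closed-loop system is exponentially stable and there are $M,\alpha>0$ such that $$\|y_n-y^{\mathrm{ref}}_n\|\le Me^{-\alpha n}\bigl(\|x_0\|+\|z_0\|+\|v_0\|\bigr)\qquad (n\ge 0)\tag{1}$$ for all $x_0\in X$, $z_0\in Z$, $v_0\in\mathbb C^q$. It solves the robust output regulation problem if, in addition, whenever $(A,B,C,D,E,F)$ is replaced by bounded operators $(\tilde A,\tilde B,\tilde C,\tilde D,\tilde E,\tilde F)$ between the same spaces for which the closed-loop system is still exponentially stable, the estimate (1) holds for the changed system for some $M,\alpha>0$ and all initial states. **Theorem.** Assume that no $\mu_k$ is an interior point of the spectrum $\sigma(A)$ (this holds in particular if the plant is stable, since then $\sigma(A)$ lies in the closed unit disc, and also if $\mu_k\in\rho(A)$ for all $k$), and that the closed-loop system with the controller $(G_1,G_2,K)$ is exponentially stable. Then: 1. $(G_1,G_2,K)$ solves the robust output regulation problem if and only if $$\operatorname{ran}(\mu_k-G_1)\cap\operatorname{ran}(G_2)=\{0\}\quad\text{for all }k\in\{1,\dots,q\},\qquad\text{and}\qquad \ker(G_2)=\{0\}.$$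 2. If $(G_1,G_2,K)$ solves the robust output regulation problem, then $$\dim\ker(\mu_k-G_1)\ge\dim Y\quad\text{for all }k\in\{1,\dots,q\},\tag{2}$$ where $\dim$ is the (possibly infinite) cardinality of an algebraic basis. 3. If $\dim Y<\infty$, then condition (2) is also sufficient for $(G_1,G_2,K)$ to solve the robust output regulation problem. -/

import Mathlib

/-!
Along the `k`-th mode of the exosystem a stable closed loop has exactly one steady state `(x, z)`,
because `μ_k ∉ σ(A_e)`. Trajectories differ from a combination of these steady states by
`A_eⁿ` applied to a constant, so regulation means that the error `e` vanishes in each of them. As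
`(μ_k - G₁) z = G₂ e` there, `ran (μ_k - G₁) ∩ ran G₂ = 0` and `ker G₂ = 0` force `e = 0`.

Conversely, stability is an open condition and `μ_k` is a limit of points of `ρ(A)`, so robustness
allows us to assume `μ_k ∈ ρ(A)`. Given `(μ_k - G₁) z = G₂ y`, take `x = (μ_k - A)⁻¹ B K z` and
choose the reference so that `(x, z)` is a steady state with error `y`; hence `y = 0`.

For the dimension count let `P(μ) = C (μ - A)⁻¹ B + D`. The Schur complement
`μ_k - G₁ - G₂ P(μ_k) K` of `μ_k - A` in `μ_k - A_e` is bijective, so `P(μ_k) K` is injective on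
`ker (μ_k - G₁)`, and it maps this kernel onto `Y` exactly when `(μ_k - G₁) z = G₂ y` forces
`y = 0`. If `dim Y < ∞`, surjectivity follows from injectivity and the comparison of dimensions.
-/

universe uX uZ uU uD uY

namespace OutputRegulation

/-- The discrete-time plant `x⁺ = A x + B u + B_d w`, `y = C x + D u + D_d w`. -/
structure Plant (X U Ud Y : Type*)
    [NormedAddCommGroup X] [NormedSpace ℂ X]
    [NormedAddCommGroup U] [NormedSpace ℂ U]
    [NormedAddCommGroup Ud] [NormedSpace ℂ Ud]
    [NormedAddCommGroup Y] [NormedSpace ℂ Y] where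
  A : X →L[ℂ] X
  B : U →L[ℂ] X
  Bd : Ud →L[ℂ] X
  C : X →L[ℂ] Y
  D : U →L[ℂ] Y
  Dd : Ud →L[ℂ] Y

/-- The diagonal exosystem `v⁺ = diag(μ₁, …, μ_q) v`, `w = E v`, `y_ref = -F v` on `ℂ^q`. -/
structure Exosystem (q : ℕ) (Ud Y : Type*)
    [NormedAddCommGroup Ud] [NormedSpace ℂ Ud]
    [NormedAddCommGroup Y] [NormedSpace ℂ Y] where
  μ : Fin q → ℂ
  E : EuclideanSpace ℂ (Fin q) →L[ℂ] Ud
  F : EuclideanSpace ℂ (Fin q) →L[ℂ] Y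

/-- The error feedback controller `z⁺ = G₁ z + G₂ e`, `u = K z`. -/
structure Controller (Y Z U : Type*)
    [NormedAddCommGroup Y] [NormedSpace ℂ Y]
    [NormedAddCommGroup Z] [NormedSpace ℂ Z]
    [NormedAddCommGroup U] [NormedSpace ℂ U] where
  G₁ : Z →L[ℂ] Z
  G₂ : Y →L[ℂ] Z
  K : Z →L[ℂ] U

/-- The system operator `S = diag(μ₁, …, μ_q)` of the exosystem. -/
noncomputable def Exosystem.S {q : ℕ} {Ud Y : Type*}
    [NormedAddCommGroup Ud] [NormedSpace ℂ Ud]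
    [NormedAddCommGroup Y] [NormedSpace ℂ Y]
    (exo : Exosystem q Ud Y) :
    EuclideanSpace ℂ (Fin q) →L[ℂ] EuclideanSpace ℂ (Fin q) :=
  Matrix.toEuclideanCLM (𝕜 := ℂ) (Matrix.diagonal exo.μ)

section ClosedLoop

variable {q : ℕ} {X U Ud Y Z : Type*}
  [NormedAddCommGroup X] [NormedSpace ℂ X]
  [NormedAddCommGroup U] [NormedSpace ℂ U]
  [NormedAddCommGroup Ud] [NormedSpace ℂ Ud]
  [NormedAddCommGroup Y] [NormedSpace ℂ Y]
  [NormedAddCommGroup Z] [NormedSpace ℂ Z]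

/-- The closed-loop operator `A_e = [A, B K; G₂ C, G₁ + G₂ D K]` on `X × Z`. -/
noncomputable def closedLoopOperator (P : Plant X U Ud Y) (ctrl : Controller Y Z U) :
    (X × Z) →L[ℂ] (X × Z) :=
  (P.A ∘L ContinuousLinearMap.fst ℂ X Z
      + (P.B ∘L ctrl.K) ∘L ContinuousLinearMap.snd ℂ X Z).prod
    ((ctrl.G₂ ∘L P.C) ∘L ContinuousLinearMap.fst ℂ X Z
      + (ctrl.G₁ + ctrl.G₂ ∘L P.D ∘L ctrl.K) ∘L ContinuousLinearMap.snd ℂ X Z)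

/-- Exponential stability of the closed-loop system: the powers of `A_e` decay exponentially. -/
def ClosedLoopStable (P : Plant X U Ud Y) (ctrl : Controller Y Z U) : Prop :=
  ∃ M > 0, ∃ α > 0, ∀ n : ℕ,
    ‖closedLoopOperator P ctrl ^ n‖ ≤ M * Real.exp (-α * n)

/-- The regulation error `e = y - y_ref` when the plant, the controller and the exosystem are in
the states `x`, `z` and `v`. -/
noncomputable def regulationError (P : Plant X U Ud Y) (exo : Exosystem q Ud Y)
    (ctrl : Controller Y Z U) (x : X) (z : Z) (v : EuclideanSpace ℂ (Fin q)) : Y :=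
  (P.C x + P.D (ctrl.K z) + P.Dd (exo.E v)) - (-(exo.F v))

/-- The states `(x_n, z_n, v_n)` of plant, controller and exosystem in the interconnection with
initial states `x₀`, `z₀`, `v₀`. -/
noncomputable def trajectory (P : Plant X U Ud Y) (exo : Exosystem q Ud Y)
    (ctrl : Controller Y Z U) (x₀ : X) (z₀ : Z) (v₀ : EuclideanSpace ℂ (Fin q)) :
    ℕ → X × Z × EuclideanSpace ℂ (Fin q)
  | 0 => (x₀, z₀, v₀)
  | n + 1 =>
    let s := trajectory P exo ctrl x₀ z₀ v₀ n
    (P.A s.1 + P.B (ctrl.K s.2.1) + P.Bd (exo.E s.2.2),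
      ctrl.G₁ s.2.1 + ctrl.G₂ (regulationError P exo ctrl s.1 s.2.1 s.2.2),
      exo.S s.2.2)

/-- The regulation error `e_n = y_n - y_ref,n` at time `n`. -/
noncomputable def errorAt (P : Plant X U Ud Y) (exo : Exosystem q Ud Y)
    (ctrl : Controller Y Z U) (x₀ : X) (z₀ : Z) (v₀ : EuclideanSpace ℂ (Fin q)) (n : ℕ) : Y :=
  let s := trajectory P exo ctrl x₀ z₀ v₀ n
  regulationError P exo ctrl s.1 s.2.1 s.2.2

/-- The regulation error decays at a uniform exponential rate for all initial states. -/
def ErrorDecays (P : Plant X U Ud Y) (exo : Exosystem q Ud Y)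
    (ctrl : Controller Y Z U) : Prop :=
  ∃ M > 0, ∃ α > 0, ∀ (x₀ : X) (z₀ : Z) (v₀ : EuclideanSpace ℂ (Fin q)) (n : ℕ),
    ‖errorAt P exo ctrl x₀ z₀ v₀ n‖
      ≤ M * Real.exp (-α * n) * (‖x₀‖ + ‖z₀‖ + ‖v₀‖)

/-- The controller solves the output regulation problem. -/
def SolvesOutputRegulation (P : Plant X U Ud Y) (exo : Exosystem q Ud Y)
    (ctrl : Controller Y Z U) : Prop :=
  ClosedLoopStable P ctrl ∧ ErrorDecays P exo ctrl

/-- The controller solves the robust output regulation problem: it solves the output regulation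
problem, and the regulation error still decays after any change of `(A, B, C, D, E, F)` that
preserves the exponential closed-loop stability. -/
def SolvesRobustOutputRegulation (P : Plant X U Ud Y) (exo : Exosystem q Ud Y)
    (ctrl : Controller Y Z U) : Prop :=
  SolvesOutputRegulation P exo ctrl ∧
    ∀ (A' : X →L[ℂ] X) (B' : U →L[ℂ] X) (C' : X →L[ℂ] Y) (D' : U →L[ℂ] Y)
      (E' : EuclideanSpace ℂ (Fin q) →L[ℂ] Ud) (F' : EuclideanSpace ℂ (Fin q) →L[ℂ] Y),
      ClosedLoopStable { P with A := A', B := B', C := C', D := D' } ctrl →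
        ErrorDecays { P with A := A', B := B', C := C', D := D' }
          { exo with E := E', F := F' } ctrl

end ClosedLoop

end OutputRegulation

namespace OutputRegulation

open Filter Topology

section PowerStable

/-- The powers of `a` decay exponentially: exponential stability of the discrete-time system
`ξ⁺ = a ξ`. -/
def PowerStable {R : Type*} [SeminormedRing R] (a : R) : Prop :=
  ∃ M > 0, ∃ α > 0, ∀ n : ℕ, ‖a ^ n‖ ≤ M * Real.exp (-α * n)

theorem tendsto_const_mul_exp_neg_mul_natCast (M : ℝ) {α : ℝ} (hα : 0 < α) :
    Tendsto (fun n : ℕ => M * Real.exp (-α * n)) atTop (𝓝 0) := by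
  have h : Tendsto (fun n : ℕ => -α * (n : ℝ)) atTop atBot :=
    tendsto_natCast_atTop_atTop.const_mul_atTop_of_neg (neg_lt_zero.2 hα)
  simpa only [mul_zero, Function.comp_apply] using (Real.tendsto_exp_atBot.comp h).const_mul M

theorem PowerStable.tendsto_norm_pow {R : Type*} [SeminormedRing R] {a : R}
    (ha : PowerStable a) : Tendsto (fun n : ℕ => ‖a ^ n‖) atTop (𝓝 0) := by
  obtain ⟨M, -, α, hα, h⟩ := ha
  exact squeeze_zero (fun _ => norm_nonneg _) h (tendsto_const_mul_exp_neg_mul_natCast M hα)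

theorem norm_pow_le_of_norm_pow_le_pow {R : Type*} [SeminormedRing R] {a : R} {N : ℕ}
    (hN : 0 < N) {ρ : ℝ} (hρ : 0 < ρ) (h : ‖a ^ N‖ ≤ ρ ^ N) (n : ℕ) :
    ‖a ^ n‖ ≤ (∑ r ∈ Finset.range N, ‖a ^ r‖ / ρ ^ r) * ρ ^ n := by
  induction n using Nat.strong_induction_on with
  | _ n ih =>
    rcases lt_or_ge n N with hn | hn
    · rw [← div_le_iff₀ (pow_pos hρ n)]
      exact Finset.single_le_sum (f := fun r => ‖a ^ r‖ / ρ ^ r) (fun r _ => by positivity)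
        (Finset.mem_range.2 hn)
    · obtain ⟨m, rfl⟩ := Nat.exists_eq_add_of_le hn
      calc ‖a ^ (N + m)‖ ≤ ‖a ^ N‖ * ‖a ^ m‖ := by rw [pow_add]; exact norm_mul_le _ _
        _ ≤ ρ ^ N * ((∑ r ∈ Finset.range N, ‖a ^ r‖ / ρ ^ r) * ρ ^ m) := by
          gcongr
          exact ih m (by omega)
        _ = (∑ r ∈ Finset.range N, ‖a ^ r‖ / ρ ^ r) * ρ ^ (N + m) := by ring

theorem powerStable_iff_exists_norm_pow_lt_one {R : Type*} [SeminormedRing R] {a : R} :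
    PowerStable a ↔ ∃ N > 0, ‖a ^ N‖ < 1 := by
  constructor
  · intro ha
    obtain ⟨N, hN₁, hN₀⟩ :=
      ((ha.tendsto_norm_pow.eventually_lt_const one_pos).and (eventually_gt_atTop 0)).exists
    exact ⟨N, hN₀, hN₁⟩
  · rintro ⟨N, hN, hlt⟩
    obtain ⟨c, hac, hc₁⟩ := exists_between hlt
    have hc₀ : 0 < c := (norm_nonneg _).trans_lt hac
    have hN' : (0 : ℝ) < N := Nat.cast_pos.2 hN
    set α : ℝ := -Real.log c / N with hα_def
    have hα : 0 < α := div_pos (neg_pos.2 (Real.log_neg hc₀ hc₁)) hN'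
    have hc : Real.exp (-α) ^ N = c := by
      rw [← Real.exp_nat_mul, hα_def, ← neg_div, neg_neg, mul_div_cancel₀ _ hN'.ne',
        Real.exp_log hc₀]
    have hbound := norm_pow_le_of_norm_pow_le_pow hN (Real.exp_pos (-α)) (hac.le.trans hc.ge)
    set M : ℝ := ∑ r ∈ Finset.range N, ‖a ^ r‖ / Real.exp (-α) ^ r
    have hM : 0 ≤ M := Finset.sum_nonneg fun _ _ => by positivity
    refine ⟨M + 1, add_pos_of_nonneg_of_pos hM one_pos, α, hα, fun n => (hbound n).trans ?_⟩
    rw [← Real.exp_nat_mul, mul_comm (n : ℝ)]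
    gcongr
    linarith

theorem isOpen_setOf_powerStable {R : Type*} [SeminormedRing R] :
    IsOpen {a : R | PowerStable a} := by
  refine isOpen_iff_eventually.2 fun a ha => ?_
  obtain ⟨N, hN, hlt⟩ := powerStable_iff_exists_norm_pow_lt_one.1 ha
  filter_upwards [(continuous_pow N).norm.continuousAt.eventually_lt_const hlt] with b hb
  exact powerStable_iff_exists_norm_pow_lt_one.2 ⟨N, hN, hb⟩

theorem PowerStable.mem_resolventSet {𝕜 R : Type*} [NormedField 𝕜] [NormedRing R]
    [NormedAlgebra 𝕜 R] [CompleteSpace R] {a : R} (ha : PowerStable a) {μ : 𝕜} (hμ : 1 ≤ ‖μ‖) :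
    μ ∈ resolventSet 𝕜 a := by
  by_contra hmem
  have hle (n : ℕ) : 1 ≤ ‖a ^ n‖ * ‖(1 : R)‖ :=
    calc 1 ≤ ‖μ ^ n‖ := by rw [norm_pow]; exact one_le_pow₀ hμ
      _ ≤ ‖a ^ n‖ * ‖(1 : R)‖ :=
        spectrum.norm_le_norm_mul_of_mem (spectrum.pow_mem_pow a n hmem)
  have hlim := ha.tendsto_norm_pow.mul_const ‖(1 : R)‖
  rw [zero_mul] at hlim
  exact absurd (ge_of_tendsto' hlim hle) (by norm_num)

end PowerStable

section Resolvent

theorem mem_closure_setOf_mem_resolventSet {𝕜 R : Type*} [CommRing 𝕜] [TopologicalSpace 𝕜]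
    [IsTopologicalRing 𝕜] [Ring R] [TopologicalSpace R] [IsTopologicalRing R] [Algebra 𝕜 R]
    [ContinuousSMul 𝕜 R] {a : R} {μ : 𝕜} (hμ : μ ∉ interior (spectrum 𝕜 a)) :
    a ∈ closure {b : R | μ ∈ resolventSet 𝕜 b} := by
  have hcont : Continuous fun l : 𝕜 => algebraMap 𝕜 R (μ - l) + a :=
    ((continuous_algebraMap 𝕜 R).comp (continuous_const.sub continuous_id)).add continuous_const
  have hmaps : Set.MapsTo (fun l : 𝕜 => algebraMap 𝕜 R (μ - l) + a) (spectrum 𝕜 a)ᶜ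
      {b : R | μ ∈ resolventSet 𝕜 b} := fun l hl => by
    have hshift := spectrum.add_mem_add_iff (a := a) (r := l) (s := μ - l)
    rw [add_sub_cancel] at hshift
    exact Set.notMem_compl_iff.1 (mt hshift.1 hl)
  rw [← Set.mem_compl_iff, ← closure_compl] at hμ
  simpa using map_mem_closure hcont hμ hmaps

theorem smul_sub_apply_eq_iff_eq_resolvent_apply {𝕜 V : Type*} [NontriviallyNormedField 𝕜]
    [SeminormedAddCommGroup V] [NormedSpace 𝕜 V] {T : V →L[𝕜] V} {μ : 𝕜}
    (hμ : μ ∈ resolventSet 𝕜 T) {x w : V} : μ • x - T x = w ↔ x = resolvent T μ w := by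
  have happly (x : V) : (algebraMap 𝕜 (V →L[𝕜] V) μ - T) x = μ • x - T x := by
    simp [Algebra.algebraMap_eq_smul_one]
  constructor
  · rintro rfl
    rw [← happly]
    exact (DFunLike.congr_fun (Ring.inverse_mul_cancel _ hμ) x).symm
  · rintro rfl
    rw [← happly]
    exact DFunLike.congr_fun (Ring.mul_inverse_cancel _ hμ) w

end Resolvent

section LinearAlgebra

theorem surjective_of_injective_of_lift_rank_le {𝕜 : Type*} {V : Type uZ} {W : Type uY}
    [Field 𝕜] [AddCommGroup V] [Module 𝕜 V] [AddCommGroup W] [Module 𝕜 W]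
    [FiniteDimensional 𝕜 W] {f : V →ₗ[𝕜] W} (hf : Function.Injective f)
    (hrank : Cardinal.lift.{uZ} (Module.rank 𝕜 W) ≤ Cardinal.lift.{uY} (Module.rank 𝕜 V)) :
    Function.Surjective f := by
  have : FiniteDimensional 𝕜 V := Module.Finite.of_injective f hf
  rw [← Module.finrank_eq_rank, ← Module.finrank_eq_rank, Cardinal.lift_natCast,
    Cardinal.lift_natCast, Nat.cast_le] at hrank
  exact (LinearMap.injective_iff_surjective_of_finrank_eq_finrank
    ((LinearMap.finrank_le_finrank_of_injective hf).antisymm hrank)).1 hf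

theorem clm_ext_euclideanSpace_single {𝕜 ι W : Type*} [RCLike 𝕜] [Finite ι] [DecidableEq ι]
    [SeminormedAddCommGroup W] [NormedSpace 𝕜 W] {f g : EuclideanSpace 𝕜 ι →L[𝕜] W}
    (h : ∀ i, f (EuclideanSpace.single i 1) = g (EuclideanSpace.single i 1)) : f = g := by
  have := Fintype.ofFinite ι
  exact ContinuousLinearMap.coe_injective <|
    (EuclideanSpace.basisFun ι 𝕜).toBasis.ext fun i => by simpa using h i

variable {R M N Q : Type*} [Ring R] [AddCommGroup M] [Module R M] [AddCommGroup N] [Module R N]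
  [AddCommGroup Q] [Module R Q] {f : M →ₗ[R] N} {g : Q →ₗ[R] N} {h : M →ₗ[R] Q}

theorem injective_domRestrict_ker (hinj : Function.Injective (f - g ∘ₗ h)) :
    Function.Injective (h.domRestrict (LinearMap.ker f)) := by
  refine (injective_iff_map_eq_zero _).2 fun w hw => Subtype.ext ?_
  have hhw : h w = 0 := hw
  have hfw : f w = 0 := w.2
  exact (injective_iff_map_eq_zero _).1 hinj w (by simp [hfw, hhw])

theorem surjective_domRestrict_ker_iff (hbij : Function.Bijective (f - g ∘ₗ h)) :
    Function.Surjective (h.domRestrict (LinearMap.ker f)) ↔ ∀ m q, f m = g q → q = 0 := by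
  constructor
  · intro hsurj m q hmq
    obtain ⟨⟨w, hfw⟩, hhw : h w = h m - q⟩ := hsurj (h m - q)
    have hmw : m - w = 0 := (injective_iff_map_eq_zero _).1 hbij.injective _ <| by
      simp [LinearMap.mem_ker.1 hfw, hhw, hmq]
    rw [← sub_sub_cancel (h m) q, ← hhw, ← map_sub, hmw, map_zero]
  · intro hzero q
    obtain ⟨m, hm : f m - g (h m) = -g q⟩ := hbij.surjective (-g q)
    have hfm : f m = g (h m - q) := by
      rw [map_sub, sub_eq_add_neg, ← hm, add_sub_cancel]
    have hhm : h m - q = 0 := hzero m _ hfm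
    exact ⟨⟨m, by rw [LinearMap.mem_ker, hfm, hhm, map_zero]⟩, sub_eq_zero.1 hhm⟩

end LinearAlgebra

section Regulation

variable {q : ℕ} {X : Type uX} {U : Type uU} {Ud : Type uD} {Y : Type uY} {Z : Type uZ}
  [NormedAddCommGroup X] [NormedSpace ℂ X]
  [NormedAddCommGroup U] [NormedSpace ℂ U]
  [NormedAddCommGroup Ud] [NormedSpace ℂ Ud]
  [NormedAddCommGroup Y] [NormedSpace ℂ Y]
  [NormedAddCommGroup Z] [NormedSpace ℂ Z]
  {P : Plant X U Ud Y} {exo : Exosystem q Ud Y} {ctrl : Controller Y Z U}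

theorem Exosystem.S_single (exo : Exosystem q Ud Y) (k : Fin q) :
    exo.S (EuclideanSpace.single k 1) = exo.μ k • EuclideanSpace.single k 1 := by
  ext i
  rcases eq_or_ne i k with rfl | h <;> simp [Exosystem.S, Matrix.mulVec_diagonal, *]

/-- The operator `C_e` of the error equation `e = C_e ξ + D_e v`. -/
noncomputable def closedLoopOutput (P : Plant X U Ud Y) (ctrl : Controller Y Z U) :
    X × Z →L[ℂ] Y :=
  P.C.coprod (P.D ∘L ctrl.K)

/-- The operator `D_e` of the error equation `e = C_e ξ + D_e v`. -/
noncomputable def closedLoopFeedthrough (P : Plant X U Ud Y) (exo : Exosystem q Ud Y) :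
    EuclideanSpace ℂ (Fin q) →L[ℂ] Y :=
  P.Dd ∘L exo.E + exo.F

/-- The operator `B_e` through which the exosystem state drives the closed loop
`ξ⁺ = A_e ξ + B_e v`, where `ξ = (x, z)`. -/
noncomputable def closedLoopInput (P : Plant X U Ud Y) (exo : Exosystem q Ud Y)
    (ctrl : Controller Y Z U) : EuclideanSpace ℂ (Fin q) →L[ℂ] X × Z :=
  (P.Bd ∘L exo.E).prod (ctrl.G₂ ∘L closedLoopFeedthrough P exo)

/-- The state `ξ_n = (x_n, z_n)` of plant and controller, without the exosystem state. -/
noncomputable def closedLoopState (P : Plant X U Ud Y) (exo : Exosystem q Ud Y)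
    (ctrl : Controller Y Z U) (ξ₀ : X × Z) (v₀ : EuclideanSpace ℂ (Fin q)) (n : ℕ) : X × Z :=
  ((trajectory P exo ctrl ξ₀.1 ξ₀.2 v₀ n).1, (trajectory P exo ctrl ξ₀.1 ξ₀.2 v₀ n).2.1)

theorem closedLoopOperator_apply (P : Plant X U Ud Y) (ctrl : Controller Y Z U) (ξ : X × Z) :
    closedLoopOperator P ctrl ξ =
      (P.A ξ.1 + P.B (ctrl.K ξ.2), ctrl.G₁ ξ.2 + ctrl.G₂ (P.C ξ.1 + P.D (ctrl.K ξ.2))) := by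
  ext
  · simp [closedLoopOperator]
  · simp only [closedLoopOperator, ContinuousLinearMap.prod_apply, add_apply,
      ContinuousLinearMap.comp_apply, ContinuousLinearMap.coe_fst',
      ContinuousLinearMap.coe_snd', map_add]
    abel

theorem regulationError_eq (P : Plant X U Ud Y) (exo : Exosystem q Ud Y)
    (ctrl : Controller Y Z U) (ξ : X × Z) (v : EuclideanSpace ℂ (Fin q)) :
    regulationError P exo ctrl ξ.1 ξ.2 v =
      closedLoopOutput P ctrl ξ + closedLoopFeedthrough P exo v := by
  simp [regulationError, closedLoopOutput, closedLoopFeedthrough, add_assoc]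

theorem trajectory_snd_snd (P : Plant X U Ud Y) (exo : Exosystem q Ud Y)
    (ctrl : Controller Y Z U) (x₀ : X) (z₀ : Z) (v₀ : EuclideanSpace ℂ (Fin q)) (n : ℕ) :
    (trajectory P exo ctrl x₀ z₀ v₀ n).2.2 = (exo.S ^ n) v₀ := by
  induction n with
  | zero => rfl
  | succ n ih => rw [pow_succ', mul_apply_eq_comp, ← ih]; rfl

theorem closedLoopState_succ (P : Plant X U Ud Y) (exo : Exosystem q Ud Y)
    (ctrl : Controller Y Z U) (ξ₀ : X × Z) (v₀ : EuclideanSpace ℂ (Fin q)) (n : ℕ) :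
    closedLoopState P exo ctrl ξ₀ v₀ (n + 1) =
      closedLoopOperator P ctrl (closedLoopState P exo ctrl ξ₀ v₀ n) +
        closedLoopInput P exo ctrl ((exo.S ^ n) v₀) := by
  rw [← trajectory_snd_snd P exo ctrl ξ₀.1 ξ₀.2 v₀ n, closedLoopOperator_apply]
  ext
  · rfl
  · simp only [closedLoopState, trajectory, regulationError, closedLoopInput,
      closedLoopFeedthrough, ContinuousLinearMap.prod_apply, ContinuousLinearMap.comp_apply,
      add_apply, Prod.snd_add, map_add, sub_neg_eq_add]
    abel

theorem errorAt_eq (P : Plant X U Ud Y) (exo : Exosystem q Ud Y)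
    (ctrl : Controller Y Z U) (ξ₀ : X × Z) (v₀ : EuclideanSpace ℂ (Fin q)) (n : ℕ) :
    errorAt P exo ctrl ξ₀.1 ξ₀.2 v₀ n =
      closedLoopOutput P ctrl (closedLoopState P exo ctrl ξ₀ v₀ n) +
        closedLoopFeedthrough P exo ((exo.S ^ n) v₀) := by
  rw [← trajectory_snd_snd P exo ctrl ξ₀.1 ξ₀.2 v₀ n]
  exact regulationError_eq P exo ctrl (closedLoopState P exo ctrl ξ₀ v₀ n) _

/-- `ξ = (x, z)` is the steady state of the closed loop excited by the `k`-th mode of the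
exosystem, i.e. `n ↦ μ_kⁿ ξ` is the trajectory starting at `ξ` and `v₀ = e_k`. -/
def IsSteadyState (P : Plant X U Ud Y) (exo : Exosystem q Ud Y) (ctrl : Controller Y Z U)
    (k : Fin q) (ξ : X × Z) : Prop :=
  exo.μ k • ξ = closedLoopOperator P ctrl ξ +
    closedLoopInput P exo ctrl (EuclideanSpace.single k 1)

theorem isSteadyState_iff {k : Fin q} {ξ : X × Z} :
    IsSteadyState P exo ctrl k ξ ↔
      exo.μ k • ξ.1 - P.A ξ.1 = P.B (ctrl.K ξ.2) + P.Bd (exo.E (EuclideanSpace.single k 1)) ∧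
      exo.μ k • ξ.2 - ctrl.G₁ ξ.2 =
        ctrl.G₂ (regulationError P exo ctrl ξ.1 ξ.2 (EuclideanSpace.single k 1)) := by
  simp only [IsSteadyState, closedLoopOperator_apply, Prod.ext_iff, Prod.smul_fst, Prod.smul_snd,
    Prod.fst_add, Prod.snd_add, closedLoopInput, closedLoopFeedthrough,
    ContinuousLinearMap.prod_apply,
    ContinuousLinearMap.comp_apply, add_apply, regulationError, sub_neg_eq_add, map_add,
    sub_eq_iff_eq_add', add_assoc]

theorem ClosedLoopStable.mem_resolventSet [CompleteSpace X] [CompleteSpace Z]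
    (hstab : ClosedLoopStable P ctrl) {μ : ℂ} (hμ : 1 ≤ ‖μ‖) :
    μ ∈ resolventSet ℂ (closedLoopOperator P ctrl) :=
  PowerStable.mem_resolventSet hstab hμ

theorem ClosedLoopStable.exists_isSteadyState [CompleteSpace X] [CompleteSpace Z]
    (hstab : ClosedLoopStable P ctrl) (exo : Exosystem q Ud Y) {k : Fin q}
    (hμ : 1 ≤ ‖exo.μ k‖) : ∃ ξ, IsSteadyState P exo ctrl k ξ :=
  ⟨_, sub_eq_iff_eq_add'.1
    ((smul_sub_apply_eq_iff_eq_resolvent_apply (hstab.mem_resolventSet hμ)).2 rfl)⟩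

theorem Exosystem.S_pow_single (exo : Exosystem q Ud Y) (k : Fin q) (n : ℕ) :
    (exo.S ^ n) (EuclideanSpace.single k 1) = exo.μ k ^ n • EuclideanSpace.single k 1 := by
  induction n with
  | zero => simp
  | succ n ih => rw [pow_succ, mul_apply_eq_comp, exo.S_single, map_smul, ih, smul_smul, pow_succ']

theorem IsSteadyState.closedLoopState_eq {k : Fin q} {ξ : X × Z}
    (hξ : IsSteadyState P exo ctrl k ξ) (n : ℕ) :
    closedLoopState P exo ctrl ξ (EuclideanSpace.single k 1) n = exo.μ k ^ n • ξ := by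
  induction n with
  | zero => simp [closedLoopState, trajectory]
  | succ n ih =>
    rw [closedLoopState_succ, ih, exo.S_pow_single, map_smul, map_smul, ← smul_add, ← hξ,
      smul_smul, pow_succ]

theorem IsSteadyState.errorAt_eq {k : Fin q} {ξ : X × Z}
    (hξ : IsSteadyState P exo ctrl k ξ) (n : ℕ) :
    errorAt P exo ctrl ξ.1 ξ.2 (EuclideanSpace.single k 1) n =
      exo.μ k ^ n • regulationError P exo ctrl ξ.1 ξ.2 (EuclideanSpace.single k 1) := by
  rw [OutputRegulation.errorAt_eq, hξ.closedLoopState_eq, exo.S_pow_single, regulationError_eq,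
    map_smul, map_smul, smul_add]

theorem ErrorDecays.regulationError_eq_zero (hdec : ErrorDecays P exo ctrl) {k : Fin q}
    (hμ : 1 ≤ ‖exo.μ k‖) {ξ : X × Z} (hξ : IsSteadyState P exo ctrl k ξ) :
    regulationError P exo ctrl ξ.1 ξ.2 (EuclideanSpace.single k 1) = 0 := by
  obtain ⟨M, -, α, hα, hbound⟩ := hdec
  have hle (n : ℕ) : ‖regulationError P exo ctrl ξ.1 ξ.2 (EuclideanSpace.single k 1)‖ ≤
      ‖errorAt P exo ctrl ξ.1 ξ.2 (EuclideanSpace.single k 1) n‖ := by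
    rw [hξ.errorAt_eq, norm_smul, norm_pow]
    exact le_mul_of_one_le_left (norm_nonneg _) (one_le_pow₀ hμ)
  have hlim := (tendsto_const_mul_exp_neg_mul_natCast M hα).mul_const
    (‖ξ.1‖ + ‖ξ.2‖ + ‖(EuclideanSpace.single k 1 : EuclideanSpace ℂ (Fin q))‖)
  rw [zero_mul] at hlim
  exact norm_le_zero_iff.1 (ge_of_tendsto' hlim fun n => (hle n).trans (hbound _ _ _ n))

section RegulatorEquations

variable {L : EuclideanSpace ℂ (Fin q) →L[ℂ] X × Z}

theorem closedLoopState_eq_of_sylvester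
    (hL : L ∘L exo.S = closedLoopOperator P ctrl ∘L L + closedLoopInput P exo ctrl)
    (ξ₀ : X × Z) (v₀ : EuclideanSpace ℂ (Fin q)) (n : ℕ) :
    closedLoopState P exo ctrl ξ₀ v₀ n =
      (closedLoopOperator P ctrl ^ n) (ξ₀ - L v₀) + L ((exo.S ^ n) v₀) := by
  induction n with
  | zero => simp [closedLoopState, trajectory]
  | succ n ih =>
    have hLn := DFunLike.congr_fun hL ((exo.S ^ n) v₀)
    simp only [ContinuousLinearMap.comp_apply, add_apply] at hLn
    rw [closedLoopState_succ, ih, map_add, pow_succ', pow_succ', mul_apply_eq_comp,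
      mul_apply_eq_comp, hLn, add_assoc]

theorem errorAt_eq_of_regulatorEquations
    (hL : L ∘L exo.S = closedLoopOperator P ctrl ∘L L + closedLoopInput P exo ctrl)
    (hreg : closedLoopOutput P ctrl ∘L L + closedLoopFeedthrough P exo = 0)
    (ξ₀ : X × Z) (v₀ : EuclideanSpace ℂ (Fin q)) (n : ℕ) :
    errorAt P exo ctrl ξ₀.1 ξ₀.2 v₀ n =
      closedLoopOutput P ctrl ((closedLoopOperator P ctrl ^ n) (ξ₀ - L v₀)) := by
  have hregn : closedLoopOutput P ctrl (L ((exo.S ^ n) v₀)) +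
      closedLoopFeedthrough P exo ((exo.S ^ n) v₀) = 0 :=
    DFunLike.congr_fun hreg ((exo.S ^ n) v₀)
  rw [errorAt_eq, closedLoopState_eq_of_sylvester hL, map_add, add_assoc, hregn, add_zero]

theorem ClosedLoopStable.errorDecays_of_regulatorEquations (hstab : ClosedLoopStable P ctrl)
    (hL : L ∘L exo.S = closedLoopOperator P ctrl ∘L L + closedLoopInput P exo ctrl)
    (hreg : closedLoopOutput P ctrl ∘L L + closedLoopFeedthrough P exo = 0) :
    ErrorDecays P exo ctrl := by
  obtain ⟨M, hM, α, hα, hbound⟩ := hstab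
  set Ce := closedLoopOutput P ctrl
  refine ⟨(‖Ce‖ + 1) * M * (1 + ‖L‖), by positivity, α, hα, fun x₀ z₀ v₀ n => ?_⟩
  have hinit : ‖(x₀, z₀) - L v₀‖ ≤ (1 + ‖L‖) * (‖x₀‖ + ‖z₀‖ + ‖v₀‖) :=
    calc ‖(x₀, z₀) - L v₀‖ ≤ ‖(x₀, z₀)‖ + ‖L v₀‖ := norm_sub_le _ _
      _ ≤ (‖x₀‖ + ‖z₀‖) + ‖L‖ * ‖v₀‖ :=
        add_le_add (max_le_add_of_nonneg (norm_nonneg _) (norm_nonneg _)) (L.le_opNorm v₀)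
      _ ≤ 1 * (‖x₀‖ + ‖z₀‖ + ‖v₀‖) + ‖L‖ * (‖x₀‖ + ‖z₀‖ + ‖v₀‖) := by
        rw [one_mul]
        exact add_le_add (le_add_of_nonneg_right (norm_nonneg v₀)) <|
          mul_le_mul_of_nonneg_left (le_add_of_nonneg_left (by positivity)) (norm_nonneg L)
      _ = (1 + ‖L‖) * (‖x₀‖ + ‖z₀‖ + ‖v₀‖) := (add_mul _ _ _).symm
  calc ‖errorAt P exo ctrl x₀ z₀ v₀ n‖
      = ‖Ce ((closedLoopOperator P ctrl ^ n) ((x₀, z₀) - L v₀))‖ :=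
        congrArg norm (errorAt_eq_of_regulatorEquations hL hreg (x₀, z₀) v₀ n)
    _ ≤ ‖Ce‖ * (‖closedLoopOperator P ctrl ^ n‖ * ‖(x₀, z₀) - L v₀‖) :=
        Ce.le_opNorm_of_le (ContinuousLinearMap.le_opNorm _ _)
    _ ≤ (‖Ce‖ + 1) * ((M * Real.exp (-α * n)) *
          ((1 + ‖L‖) * (‖x₀‖ + ‖z₀‖ + ‖v₀‖))) := by
        gcongr
        · exact le_add_of_nonneg_right zero_le_one
        · exact hbound n
    _ = (‖Ce‖ + 1) * M * (1 + ‖L‖) * Real.exp (-α * n) * (‖x₀‖ + ‖z₀‖ + ‖v₀‖) := by ring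

end RegulatorEquations

theorem ClosedLoopStable.errorDecays_of_isSteadyState (hstab : ClosedLoopStable P ctrl)
    {ξ : Fin q → X × Z} (hξ : ∀ k, IsSteadyState P exo ctrl k (ξ k))
    (herr : ∀ k, regulationError P exo ctrl (ξ k).1 (ξ k).2 (EuclideanSpace.single k 1) = 0) :
    ErrorDecays P exo ctrl := by
  let L := (EuclideanSpace.basisFun (Fin q) ℂ).toBasis.constrL ξ
  have hL (k : Fin q) : L (EuclideanSpace.single k 1) = ξ k := by
    rw [← EuclideanSpace.basisFun_apply, ← OrthonormalBasis.coe_toBasis]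
    exact (EuclideanSpace.basisFun (Fin q) ℂ).toBasis.constrL_basis ξ k
  refine hstab.errorDecays_of_regulatorEquations (L := L)
    (clm_ext_euclideanSpace_single fun k => ?_) (clm_ext_euclideanSpace_single fun k => ?_)
  · simp only [ContinuousLinearMap.comp_apply, add_apply, exo.S_single, map_smul, hL]
    exact hξ k
  · simpa only [ContinuousLinearMap.comp_apply, add_apply, zero_apply, hL,
      ← regulationError_eq] using herr k

/-- The `𝒢`-conditions on the controller, which characterise robust regulation of signals with the
frequencies `μ`. The family `μ` need not come from an exosystem. -/
def Controller.GConditions {ι : Type*} (ctrl : Controller Y Z U) (μ : ι → ℂ) : Prop :=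
  (∀ k, LinearMap.range (μ k • ContinuousLinearMap.id ℂ Z - ctrl.G₁).toLinearMap
      ⊓ LinearMap.range ctrl.G₂.toLinearMap = ⊥) ∧
    LinearMap.ker ctrl.G₂.toLinearMap = ⊥

theorem Controller.gConditions_iff {ι : Type*} [Nonempty ι] {μ : ι → ℂ} :
    ctrl.GConditions μ ↔ ∀ k z y, μ k • z - ctrl.G₁ z = ctrl.G₂ y → y = 0 := by
  simp only [Controller.GConditions, Submodule.eq_bot_iff, LinearMap.mem_ker]
  constructor
  · rintro ⟨hrange, hker⟩ k z y hzy
    exact hker y (hrange k _ ⟨⟨z, by simpa using hzy⟩, ⟨y, rfl⟩⟩)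
  · refine fun h => ⟨?_, fun y hy => h (Classical.arbitrary ι) 0 y ?_⟩
    · rintro k _ ⟨⟨z, hz⟩, ⟨y, rfl⟩⟩
      rw [h k z y (by simpa using hz), map_zero]
    · simpa using hy.symm

theorem Controller.GConditions.errorDecays [CompleteSpace X] [CompleteSpace Z]
    (hG : ctrl.GConditions exo.μ) (hμ : ∀ k, 1 ≤ ‖exo.μ k‖) (hstab : ClosedLoopStable P ctrl) :
    ErrorDecays P exo ctrl := by
  choose ξ hξ using fun k => hstab.exists_isSteadyState exo (hμ k)
  refine hstab.errorDecays_of_isSteadyState hξ fun k => ?_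
  have : Nonempty (Fin q) := ⟨k⟩
  exact Controller.gConditions_iff.1 hG k (ξ k).2 _ (isSteadyState_iff.1 (hξ k)).2

theorem Controller.GConditions.solvesRobustOutputRegulation [CompleteSpace X] [CompleteSpace Z]
    (hG : ctrl.GConditions exo.μ) (hμ : ∀ k, 1 ≤ ‖exo.μ k‖) (hstab : ClosedLoopStable P ctrl) :
    SolvesRobustOutputRegulation P exo ctrl :=
  ⟨⟨hstab, hG.errorDecays hμ hstab⟩, fun _ _ _ _ E' F' hstab' =>
    GConditions.errorDecays (exo := { exo with E := E', F := F' }) hG hμ hstab'⟩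

theorem closedLoopOperator_update_A (P : Plant X U Ud Y) (ctrl : Controller Y Z U)
    (A' : X →L[ℂ] X) :
    closedLoopOperator { P with A := A' } ctrl = closedLoopOperator P ctrl +
      ContinuousLinearMap.inl ℂ X Z ∘L (A' - P.A) ∘L ContinuousLinearMap.fst ℂ X Z := by
  refine ContinuousLinearMap.ext fun ξ => ?_
  rw [add_apply, closedLoopOperator_apply, closedLoopOperator_apply]
  ext
  · simp only [ContinuousLinearMap.comp_apply, sub_apply, ContinuousLinearMap.coe_fst',
      ContinuousLinearMap.inl_apply, Prod.mk_add_mk]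
    abel
  · simp

theorem isOpen_setOf_closedLoopStable (P : Plant X U Ud Y) (ctrl : Controller Y Z U) :
    IsOpen {A' : X →L[ℂ] X | ClosedLoopStable { P with A := A' } ctrl} := by
  have hcont : Continuous fun A' : X →L[ℂ] X => closedLoopOperator { P with A := A' } ctrl := by
    simp only [closedLoopOperator_update_A]
    fun_prop
  exact isOpen_setOf_powerStable.preimage hcont

theorem ClosedLoopStable.exists_mem_resolventSet (hstab : ClosedLoopStable P ctrl) {μ : ℂ}
    (hμ : μ ∉ interior (spectrum ℂ P.A)) :
    ∃ A' : X →L[ℂ] X, ClosedLoopStable { P with A := A' } ctrl ∧ μ ∈ resolventSet ℂ A' :=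
  mem_closure_iff.1 (mem_closure_setOf_mem_resolventSet hμ) _
    (isOpen_setOf_closedLoopStable P ctrl) hstab

theorem SolvesRobustOutputRegulation.of_closedLoopStable
    (hrob : SolvesRobustOutputRegulation P exo ctrl) {A' : X →L[ℂ] X}
    (hstab : ClosedLoopStable { P with A := A' } ctrl) :
    SolvesRobustOutputRegulation { P with A := A' } exo ctrl :=
  ⟨⟨hstab, hrob.2 A' P.B P.C P.D exo.E exo.F hstab⟩, hrob.2⟩

theorem SolvesRobustOutputRegulation.eq_zero_of_smul_sub_eq_smul_sub_eq
    (hrob : SolvesRobustOutputRegulation P exo ctrl) {k : Fin q} (hμ : 1 ≤ ‖exo.μ k‖)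
    {x : X} {z : Z} {y : Y} (hx : exo.μ k • x - P.A x = P.B (ctrl.K z))
    (hz : exo.μ k • z - ctrl.G₁ z = ctrl.G₂ y) : y = 0 := by
  -- Switch off the disturbance and choose the reference so that `(x, z)` has error `y`.
  let exo' : Exosystem q Ud Y :=
    { exo with E := 0, F := (EuclideanSpace.proj k).smulRight (y - (P.C x + P.D (ctrl.K z))) }
  have herr : regulationError P exo' ctrl x z (EuclideanSpace.single k 1) = y := by
    simp [regulationError, exo']
  have hdec : ErrorDecays P exo' ctrl := hrob.2 P.A P.B P.C P.D exo'.E exo'.F hrob.1.1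
  have hsteady : IsSteadyState P exo' ctrl k (x, z) :=
    isSteadyState_iff.2 ⟨by simpa [exo'] using hx, by rw [herr]; exact hz⟩
  rw [← herr]
  exact hdec.regulationError_eq_zero hμ hsteady

theorem SolvesRobustOutputRegulation.gConditions [Nonempty (Fin q)]
    (hrob : SolvesRobustOutputRegulation P exo ctrl) (hμ : ∀ k, 1 ≤ ‖exo.μ k‖)
    (hA : ∀ k, exo.μ k ∉ interior (spectrum ℂ P.A)) : ctrl.GConditions exo.μ := by
  refine Controller.gConditions_iff.2 fun k z y hzy => ?_
  obtain ⟨A', hstab', hρ⟩ := hrob.1.1.exists_mem_resolventSet (hA k)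
  have hx := (smul_sub_apply_eq_iff_eq_resolvent_apply hρ (w := P.B (ctrl.K z))).2 rfl
  exact (hrob.of_closedLoopStable hstab').eq_zero_of_smul_sub_eq_smul_sub_eq (hμ k) hx hzy

theorem solvesRobustOutputRegulation_iff_gConditions [CompleteSpace X] [CompleteSpace Z]
    [Nonempty (Fin q)] (hμ : ∀ k, 1 ≤ ‖exo.μ k‖)
    (hA : ∀ k, exo.μ k ∉ interior (spectrum ℂ P.A)) (hstab : ClosedLoopStable P ctrl) :
    SolvesRobustOutputRegulation P exo ctrl ↔ ctrl.GConditions exo.μ :=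
  ⟨fun hrob => hrob.gConditions hμ hA, fun hG => hG.solvesRobustOutputRegulation hμ hstab⟩

/-- The transfer function `P(μ) = C (μ - A)⁻¹ B + D` of the plant from `u` to `y`. For
`μ ∈ σ(A)`, where `resolvent` is `0`, it takes the junk value `D`. -/
noncomputable def Plant.transferFunction (P : Plant X U Ud Y) (μ : ℂ) : U →L[ℂ] Y :=
  P.C ∘L resolvent P.A μ ∘L P.B + P.D

/-- The Schur complement `μ - G₁ - G₂ P(μ) K` of `μ - A` in `μ - A_e`. -/
noncomputable def schurComplement (P : Plant X U Ud Y) (ctrl : Controller Y Z U) (μ : ℂ) :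
    Z →ₗ[ℂ] Z :=
  (μ • ContinuousLinearMap.id ℂ Z - ctrl.G₁).toLinearMap -
    ctrl.G₂.toLinearMap ∘ₗ (P.transferFunction μ ∘L ctrl.K).toLinearMap

theorem smul_sub_closedLoopOperator_eq_iff {μ : ℂ} (hρ : μ ∈ resolventSet ℂ P.A) {ξ : X × Z}
    {w : Z} : μ • ξ - closedLoopOperator P ctrl ξ = (0, w) ↔
      ξ.1 = resolvent P.A μ (P.B (ctrl.K ξ.2)) ∧ schurComplement P ctrl μ ξ.2 = w := by
  have hfst : μ • ξ.1 - (P.A ξ.1 + P.B (ctrl.K ξ.2)) = 0 ↔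
      ξ.1 = resolvent P.A μ (P.B (ctrl.K ξ.2)) := by
    rw [← sub_sub, sub_eq_zero, smul_sub_apply_eq_iff_eq_resolvent_apply hρ]
  simp only [closedLoopOperator_apply, Prod.ext_iff, Prod.fst_sub, Prod.snd_sub, Prod.smul_fst,
    Prod.smul_snd, hfst]
  refine and_congr_right fun hx => ?_
  rw [hx, ← sub_sub]
  rfl

theorem ClosedLoopStable.bijective_schurComplement [CompleteSpace X] [CompleteSpace Z]
    (hstab : ClosedLoopStable P ctrl) {μ : ℂ} (hμ : 1 ≤ ‖μ‖) (hρ : μ ∈ resolventSet ℂ P.A) :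
    Function.Bijective (schurComplement P ctrl μ) := by
  have hiff {ξ : X × Z} {w : Z} :=
    (smul_sub_closedLoopOperator_eq_iff (ctrl := ctrl) hρ (ξ := ξ) (w := w)).symm.trans
      (smul_sub_apply_eq_iff_eq_resolvent_apply (hstab.mem_resolventSet hμ))
  refine (Function.bijective_iff_existsUnique _).2 fun w => ⟨_, (hiff.2 rfl).2, fun z hz => ?_⟩
  exact congrArg Prod.snd (hiff.1 ⟨rfl, hz⟩ : (resolvent P.A μ (P.B (ctrl.K z)), z) = _)

theorem ClosedLoopStable.lift_rank_le [CompleteSpace X] [CompleteSpace Z]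
    (hstab : ClosedLoopStable P ctrl) {μ : ℂ} (hμ : 1 ≤ ‖μ‖)
    (hA : μ ∉ interior (spectrum ℂ P.A))
    (hG : ∀ z y, μ • z - ctrl.G₁ z = ctrl.G₂ y → y = 0) :
    Cardinal.lift.{uZ} (Module.rank ℂ Y) ≤ Cardinal.lift.{uY} (Module.rank ℂ
      (LinearMap.ker (μ • ContinuousLinearMap.id ℂ Z - ctrl.G₁).toLinearMap)) := by
  obtain ⟨A', hstab', hρ⟩ := hstab.exists_mem_resolventSet hA
  exact LinearMap.lift_rank_le_of_surjective _
    ((surjective_domRestrict_ker_iff (hstab'.bijective_schurComplement hμ hρ)).2 hG)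

theorem ClosedLoopStable.eq_zero_of_lift_rank_le [CompleteSpace X] [CompleteSpace Z]
    [FiniteDimensional ℂ Y] (hstab : ClosedLoopStable P ctrl) {μ : ℂ} (hμ : 1 ≤ ‖μ‖)
    (hA : μ ∉ interior (spectrum ℂ P.A))
    (hrank : Cardinal.lift.{uZ} (Module.rank ℂ Y) ≤ Cardinal.lift.{uY} (Module.rank ℂ
      (LinearMap.ker (μ • ContinuousLinearMap.id ℂ Z - ctrl.G₁).toLinearMap)))
    {z : Z} {y : Y} (hzy : μ • z - ctrl.G₁ z = ctrl.G₂ y) : y = 0 := by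
  obtain ⟨A', hstab', hρ⟩ := hstab.exists_mem_resolventSet hA
  have hbij := hstab'.bijective_schurComplement hμ hρ
  have hsurj := surjective_of_injective_of_lift_rank_le
    (injective_domRestrict_ker hbij.injective) hrank
  exact (surjective_domRestrict_ker_iff hbij).1 hsurj z y hzy

end Regulation

end OutputRegulation

theorem mainTheorem5_general
    {X : Type uX} [NormedAddCommGroup X] [NormedSpace ℂ X] [CompleteSpace X]
    {Z : Type uZ} [NormedAddCommGroup Z] [NormedSpace ℂ Z] [CompleteSpace Z]
    {U : Type uU} [NormedAddCommGroup U] [NormedSpace ℂ U]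
    {Ud : Type uD} [NormedAddCommGroup Ud] [NormedSpace ℂ Ud]
    {Y : Type uY} [NormedAddCommGroup Y] [NormedSpace ℂ Y]
    {q : ℕ} (hq : 0 < q)
    (P : OutputRegulation.Plant X U Ud Y)
    (exo : OutputRegulation.Exosystem q Ud Y)
    (ctrl : OutputRegulation.Controller Y Z U)
    (hμ : ∀ k, 1 ≤ ‖exo.μ k‖)
    (hA : ∀ k, exo.μ k ∉ interior (spectrum ℂ P.A))
    (hstab : OutputRegulation.ClosedLoopStable P ctrl) :
    (OutputRegulation.SolvesRobustOutputRegulation P exo ctrl ↔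
      (∀ k, LinearMap.range (exo.μ k • ContinuousLinearMap.id ℂ Z - ctrl.G₁).toLinearMap
          ⊓ LinearMap.range ctrl.G₂.toLinearMap = ⊥) ∧
        LinearMap.ker ctrl.G₂.toLinearMap = ⊥) ∧
    (OutputRegulation.SolvesRobustOutputRegulation P exo ctrl →
      ∀ k, Cardinal.lift.{uZ} (Module.rank ℂ Y) ≤ Cardinal.lift.{uY} (Module.rank ℂ
        (LinearMap.ker (exo.μ k • ContinuousLinearMap.id ℂ Z - ctrl.G₁).toLinearMap))) ∧
    (FiniteDimensional ℂ Y →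
      (∀ k, Cardinal.lift.{uZ} (Module.rank ℂ Y) ≤ Cardinal.lift.{uY} (Module.rank ℂ
        (LinearMap.ker (exo.μ k • ContinuousLinearMap.id ℂ Z - ctrl.G₁).toLinearMap))) →
      OutputRegulation.SolvesRobustOutputRegulation P exo ctrl) := by
  have : Nonempty (Fin q) := Fin.pos_iff_nonempty.1 hq
  have hiff := OutputRegulation.solvesRobustOutputRegulation_iff_gConditions hμ hA hstab
  refine ⟨hiff, fun hrob k => ?_, fun _ hrank => hiff.2 ?_⟩
  · exact hstab.lift_rank_le (hμ k) (hA k)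
      (OutputRegulation.Controller.gConditions_iff.1 (hiff.1 hrob) k)
  · exact OutputRegulation.Controller.gConditions_iff.2 fun k _ _ =>
      hstab.eq_zero_of_lift_rank_le (hμ k) (hA k) (hrank k)

theorem mainTheorem5
    {X : Type uX} [NormedAddCommGroup X] [NormedSpace ℂ X] [CompleteSpace X]
    {Z : Type uZ} [NormedAddCommGroup Z] [NormedSpace ℂ Z] [CompleteSpace Z]
    {U : Type uU} [NormedAddCommGroup U] [InnerProductSpace ℂ U] [CompleteSpace U]
    {Ud : Type uD} [NormedAddCommGroup Ud] [InnerProductSpace ℂ Ud] [CompleteSpace Ud]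
    {Y : Type uY} [NormedAddCommGroup Y] [InnerProductSpace ℂ Y] [CompleteSpace Y]
    {q : ℕ} (hq : 0 < q)
    (P : OutputRegulation.Plant X U Ud Y)
    (exo : OutputRegulation.Exosystem q Ud Y)
    (ctrl : OutputRegulation.Controller Y Z U)
    (hμ : ∀ k, ‖exo.μ k‖ = 1)
    (hA : ∀ k, exo.μ k ∉ interior (spectrum ℂ P.A))
    (hstab : OutputRegulation.ClosedLoopStable P ctrl) :
    (OutputRegulation.SolvesRobustOutputRegulation P exo ctrl ↔
      (∀ k, LinearMap.range (exo.μ k • ContinuousLinearMap.id ℂ Z - ctrl.G₁).toLinearMap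
          ⊓ LinearMap.range ctrl.G₂.toLinearMap = ⊥) ∧
        LinearMap.ker ctrl.G₂.toLinearMap = ⊥) ∧
    (OutputRegulation.SolvesRobustOutputRegulation P exo ctrl →
      ∀ k, Cardinal.lift.{uZ} (Module.rank ℂ Y) ≤ Cardinal.lift.{uY} (Module.rank ℂ
        (LinearMap.ker (exo.μ k • ContinuousLinearMap.id ℂ Z - ctrl.G₁).toLinearMap))) ∧
    (FiniteDimensional ℂ Y →
      (∀ k, Cardinal.lift.{uZ} (Module.rank ℂ Y) ≤ Cardinal.lift.{uY} (Module.rank ℂ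
        (LinearMap.ker (exo.μ k • ContinuousLinearMap.id ℂ Z - ctrl.G₁).toLinearMap))) →
      OutputRegulation.SolvesRobustOutputRegulation P exo ctrl) :=
  mainTheorem5_general hq P exo ctrl (fun k => (hμ k).ge) hA hstab
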